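/- Let $(1,b,c,d)$ with $1<b<c<d$ be a $D(-1)$-quadruple of positive integers, i.e. the product of any two distinct elements of $\{1,b,c,d\}$ decreased by $1$ is a perfect square. Let $r,s,t,z$ be the positive integers with $$b-1=r^2,\qquad c-1=s^2,\qquad bc-1=t^2,\qquad cd-1=z^2 .$$ Let $\rho\in\{-1,1\}$ and let $m,n\ge 0$ be integers such that $z=v_m=w_n$, where, for $p\ge 0$, $$v_p=\frac{s}{2}\Bigl((s+\sqrt c)^{2p}+(s-\sqrt c)^{2p}\Bigr),$$ $$w_p=\frac{s\sqrt b+\rho r\sqrt c}{2\sqrt b}\,(t+\sqrt{bc})^{2p}+\frac{s\sqrt b-\rho r\sqrt c}{2\sqrt b}\,(t-\sqrt{bc})^{2p}.$$ Suppose $n\ge 1000$. Then: (i) if $b^{1.32}\le c<b^{1.40}$, then $n\ge\left(\dfrac{15.927\,b^2}{c}\right)^{1/4}$; (ii) if $b^{1.27}\le c<b^{1.32}$, then $n\ge\left(\dfrac{15.830\,b^2}{c}\right)^{1/4}$; (iii) if $b^{1.22}\le c<b^{1.27}$, then $n\ge\left(\dfrac{15.387\,b^2}{c}\right)^{1/4}$;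 (iv) if $b^{1.16}\le c<b^{1.22}$, then $n\ge\left(\dfrac{12.850\,b^2}{c}\right)^{1/4}$. -/

import Mathlib

/-- `S` is a Diophantine `D(k)`-set: a finite set of positive integers such that the product of
any two distinct elements, increased by `k`, is a perfect square. -/
def IsDiophantineSet (k : ℤ) (S : Finset ℕ) : Prop :=
  (∀ a ∈ S, 0 < a) ∧ ∀ a ∈ S, ∀ b ∈ S, a ≠ b → IsSquare ((a : ℤ) * (b : ℤ) + k)

/-- A quadruple `(1, b, c, d)` with `1 < b < c < d` whose entries form a `D(-1)`-set. -/
def IsDQuadruple (b c d : ℕ) : Prop :=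
  1 < b ∧ b < c ∧ c < d ∧ IsDiophantineSet (-1) {1, b, c, d}

/-- The sequence
`v_p = (s / 2) * ((s + √c)^(2p) + (s - √c)^(2p))`. -/
noncomputable def seqV (c s : ℕ) (p : ℕ) : ℝ :=
  (s : ℝ) / 2 *
    (((s : ℝ) + √(c : ℝ)) ^ (2 * p) + ((s : ℝ) - √(c : ℝ)) ^ (2 * p))

/-- The sequence
`w_p = ((s√b + ρ r√c) / (2√b)) * (t + √(bc))^(2p) + ((s√b - ρ r√c) / (2√b)) * (t - √(bc))^(2p)`. -/
noncomputable def seqW (b c r s t : ℕ) (ρ : ℤ) (p : ℕ) : ℝ :=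
  ((s : ℝ) * √(b : ℝ) + (ρ : ℝ) * (r : ℝ) * √(c : ℝ)) / (2 * √(b : ℝ)) *
      ((t : ℝ) + √((b : ℝ) * (c : ℝ))) ^ (2 * p) +
    ((s : ℝ) * √(b : ℝ) - (ρ : ℝ) * (r : ℝ) * √(c : ℝ)) / (2 * √(b : ℝ)) *
      ((t : ℝ) - √((b : ℝ) * (c : ℝ))) ^ (2 * p)

/-! All four constants are below 16, and all four ranges lie in `b ^ 29 ≤ c ^ 25`, `c ^ 5 < b ^ 7`
(exponents 1.16 and 1.40), so it suffices to prove `16 * b ^ 2 ≤ n ^ 4 * c` there.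

Expanding `v_m = w_n` modulo `c ^ 2` gives the congruence of `dvd_of_pellPow_eq`, where `f = t - r *
s` satisfies `f² + 2frs = r² + s²`. This Markov-type equation admits Vieta jumping: `s > r > S = 2fr
- s > T = 2fS - r > U = 2fT - S`.

Suppose `n ^ 4 * c < 16 * b ^ 2`, and let `q` be the quotient in the congruence. Then `r²(2n² + ρn)
- s²q` is small, and each jump carries this near-proportionality to the next pair (`descent_next`):
`2n² + ρn, q, K₁, K₂, K₃` obey the recurrence with multiplier `4f² - 2`. The discrepancy stays below
the relevant squares, so the quotients are positive and decreasing up to `K₂`, and `0 ≤ K₃ < K₂`.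
Size estimates (`final_power_bound`) leave `f ∈ {6, 7, 8}`, `K₂ = 1`, `K₃ = 0`; running the
recurrence back determines `2n² + ρn`, and no `n` fits (`two_mul_sq_add_ne`). -/

/-! ### Integer form of the sequences and the congruence modulo `c`. -/

/-- The pair `(A, B)` with `(u + √D) ^ (2 * p) = A + B * √D` when `u ^ 2 = D - 1`. -/
def pellPow (u D : ℤ) : ℕ → ℤ × ℤ
  | 0 => (1, 0)
  | p + 1 =>
    ((2 * D - 1) * (pellPow u D p).1 + 2 * u * D * (pellPow u D p).2,
      2 * u * (pellPow u D p).1 + (2 * D - 1) * (pellPow u D p).2)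

theorem pellPow_modEq {u D : ℤ} (h : u ^ 2 = D - 1) (p : ℕ) :
    (∃ k, (pellPow u D p).1 = (-1) ^ p * (1 - 2 * (p : ℤ) ^ 2 * D) + D ^ 2 * k) ∧
      ∃ k, (pellPow u D p).2 = -((-1) ^ p * (2 * u * p)) + D * k := by
  induction p with
  | zero => exact ⟨⟨0, by simp [pellPow]⟩, ⟨0, by simp [pellPow]⟩⟩
  | succ p ih =>
    obtain ⟨⟨k, hk⟩, ⟨l, hl⟩⟩ := ih
    refine ⟨⟨(2 * D - 1) * k + 2 * u * l - (-1) ^ p * 4 * p ^ 2 - (-1) ^ p * 4 * p, ?_⟩,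
      ⟨2 * u * (-1) ^ p * (-2 * p ^ 2) + 2 * u * D * k + (2 * D - 1) * l
        - (-1) ^ p * 4 * u * p, ?_⟩⟩
    · simp only [pellPow, hk, hl]
      push_cast
      linear_combination (-4 * D * (-1) ^ p * p) * h
    · simp only [pellPow, hk, hl]
      push_cast
      ring

theorem add_sqrt_pow_eq {u D : ℤ} (hD : 0 ≤ D) (h : u ^ 2 = D - 1) (p : ℕ) :
    ((u : ℝ) + √(D : ℝ)) ^ (2 * p) = (pellPow u D p).1 + (pellPow u D p).2 * √(D : ℝ) ∧
      ((u : ℝ) - √(D : ℝ)) ^ (2 * p) = (pellPow u D p).1 - (pellPow u D p).2 * √(D : ℝ) := by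
  have hD' : √(D : ℝ) ^ 2 = D := Real.sq_sqrt (by exact_mod_cast hD)
  have h' : (u : ℝ) ^ 2 = D - 1 := by exact_mod_cast h
  induction p with
  | zero => simp [pellPow]
  | succ p ih =>
    obtain ⟨h1, h2⟩ := ih
    constructor
    · rw [mul_add, pow_add, h1]
      simp only [pellPow]
      push_cast
      linear_combination
        ((pellPow u D p).1 + (pellPow u D p).2 * √(D : ℝ)) * h' +
        ((pellPow u D p).1 + (pellPow u D p).2 * √(D : ℝ) + 2 * u * (pellPow u D p).2) * hD'
    · rw [mul_add, pow_add, h2]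
      simp only [pellPow]
      push_cast
      linear_combination
        ((pellPow u D p).1 - (pellPow u D p).2 * √(D : ℝ)) * h' +
        ((pellPow u D p).1 - (pellPow u D p).2 * √(D : ℝ) + 2 * u * (pellPow u D p).2) * hD'

theorem seqV_eq {c s : ℕ} (hs : c = s ^ 2 + 1) (p : ℕ) :
    seqV c s p = ((s * (pellPow s c p).1 : ℤ) : ℝ) := by
  obtain ⟨h1, h2⟩ := add_sqrt_pow_eq (u := s) (D := c) (by positivity)
    (by rw [hs]; push_cast; ring) p
  simp only [Int.cast_natCast] at h1 h2
  rw [seqV, h1, h2]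
  push_cast
  ring

theorem seqW_eq {b c r s t : ℕ} {ρ : ℤ} (hb : 0 < b) (ht : b * c = t ^ 2 + 1) (p : ℕ) :
    seqW b c r s t ρ p =
      ((s * (pellPow t (b * c) p).1 + ρ * r * c * (pellPow t (b * c) p).2 : ℤ) : ℝ) := by
  obtain ⟨h1, h2⟩ := add_sqrt_pow_eq (u := t) (D := b * c) (by positivity)
    (by have : (b : ℤ) * c = t ^ 2 + 1 := by exact_mod_cast ht
        rw [this]; ring) p
  simp only [Int.cast_natCast, Int.cast_mul] at h1 h2
  rw [seqW, h1, h2]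
  have hb' : √(b : ℝ) ≠ 0 := by positivity
  have hc : √(c : ℝ) ^ 2 = c := Real.sq_sqrt (by positivity)
  rw [Real.sqrt_mul (by positivity)]
  push_cast
  field_simp
  linear_combination (2 * (ρ : ℝ) * r * (pellPow t (b * c) p).2 * √(b : ℝ)) * hc

/-- The congruence modulo `c` satisfied by the indices of a common term of the two sequences. -/
theorem dvd_of_pellPow_eq {b c r s t ρ : ℤ} {m n : ℕ} (hc : 2 < c)
    (hr : b = r ^ 2 + 1) (hs : c = s ^ 2 + 1) (ht : b * c = t ^ 2 + 1)
    (h : s * (pellPow s c m).1 =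
      s * (pellPow t (b * c) n).1 + ρ * r * c * (pellPow t (b * c) n).2) :
    c ∣ 2 * (b * n ^ 2 - m ^ 2) + ρ * n * (b + (t - r * s) ^ 2) := by
  obtain ⟨⟨k, hk⟩, -⟩ := pellPow_modEq (u := s) (D := c) (by linarith) m
  obtain ⟨⟨l, hl⟩, ⟨j, hj⟩⟩ := pellPow_modEq (u := t) (D := b * c) (by linarith) n
  rw [hk, hl, hj] at h
  -- Modulo `c` the relation reads `s(-1)^m ≡ s(-1)^n`; as `s² ≡ -1` and `c > 2`, the signs agree.
  have hpar : (-1 : ℤ) ^ m = (-1) ^ n := by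
    have hd : c ∣ (-1 : ℤ) ^ m - (-1) ^ n := by
      refine ⟨(-1) ^ m - (-1) ^ n + s * (-s * (-1) ^ m * (2 * m ^ 2) + s * c * k
        + s * (-1) ^ n * (2 * n ^ 2 * b) - s * b ^ 2 * c * l + ρ * r * ((-1) ^ n * (2 * t * n))
        - ρ * r * b * c * j), ?_⟩
      linear_combination (-s) * h - ((-1) ^ m - (-1) ^ n) * hs
    rcases neg_one_pow_eq_or ℤ m with h1 | h1 <;> rcases neg_one_pow_eq_or ℤ n with h2 | h2 <;>
      rw [h1, h2] at hd ⊢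
    · have := Int.le_of_dvd (by norm_num) hd; omega
    · have := Int.le_of_dvd (by norm_num) (hd.neg_right); omega
  rw [hpar] at h
  have he : ((-1 : ℤ) ^ n) ^ 2 = 1 := by rw [← pow_mul, mul_comm, pow_mul]; simp
  set e : ℤ := (-1) ^ n
  have key : 2 * (s * (b * n ^ 2 - m ^ 2) + ρ * r * t * n) =
      c * (e * (s * b ^ 2 * l + ρ * r * b * j - s * k)) := by
    apply mul_left_cancel₀ (show c ≠ 0 by linarith)
    linear_combination e * h -
      (2 * c * (s * (b * n ^ 2 - m ^ 2) + ρ * r * t * n)) * he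
  -- Multiply `key` by `-s`, using `s² ≡ -1` and `2rst ≡ -(b + (t - rs)²)` modulo `c`.
  refine ⟨2 * (b * n ^ 2 - m ^ 2) + ρ * n * (2 * b - 1) -
    s * (e * (s * b ^ 2 * l + ρ * r * b * j - s * k)), ?_⟩
  linear_combination (-s) * key - 2 * (b * n ^ 2 - m ^ 2) * hs - ρ * n * (c - 1) * hr
    - ρ * n * r ^ 2 * hs - ρ * n * ht

/-! ### Growth of the sequences and the bound `m ≤ 2n`. -/

theorem le_seqV {c s : ℕ} (hs : c = s ^ 2 + 1) (p : ℕ) :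
    (s : ℝ) / 2 * (4 * (s : ℝ) ^ 2) ^ p ≤ seqV c s p := by
  have h1 : (s : ℝ) ≤ √(c : ℝ) := by
    apply Real.le_sqrt_of_sq_le
    rw [hs]; push_cast; linarith
  have h2 : (4 * (s : ℝ) ^ 2) ^ p ≤ ((s : ℝ) + √(c : ℝ)) ^ (2 * p) := by
    rw [pow_mul]
    gcongr
    nlinarith [Nat.cast_nonneg (α := ℝ) s]
  have h3 : 0 ≤ ((s : ℝ) - √(c : ℝ)) ^ (2 * p) := by
    rw [pow_mul]; positivity
  rw [seqV]
  gcongr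
  linarith

theorem seqW_le {b c r s t : ℕ} {ρ : ℤ} (hb : 0 < b) (hc : 0 < c) (hr : b = r ^ 2 + 1)
    (hs : c = s ^ 2 + 1) (ht : b * c = t ^ 2 + 1) (hρ : ρ = 1 ∨ ρ = -1) (p : ℕ) :
    seqW b c r s t ρ p ≤ 2 * √(c : ℝ) * (4 * ((b : ℝ) * c)) ^ p := by
  have hrb : (r : ℝ) ≤ √(b : ℝ) := by
    apply Real.le_sqrt_of_sq_le
    rw [hr]; push_cast; linarith
  have hsc : (s : ℝ) ≤ √(c : ℝ) := by
    apply Real.le_sqrt_of_sq_le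
    rw [hs]; push_cast; linarith
  have hbc : √((b : ℝ) * c) ^ 2 = b * c := Real.sq_sqrt (by positivity)
  have ht' : (b : ℝ) * c = t ^ 2 + 1 := by exact_mod_cast ht
  have ht0 : (0 : ℝ) ≤ t := Nat.cast_nonneg t
  have htbc : (t : ℝ) ≤ √((b : ℝ) * c) := Real.le_sqrt_of_sq_le (by linarith)
  have hone : (1 : ℝ) ≤ b * c := by nlinarith
  have hP : ((t : ℝ) + √((b : ℝ) * c)) ^ (2 * p) ≤ (4 * ((b : ℝ) * c)) ^ p := by
    rw [pow_mul]
    gcongr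
    nlinarith
  have hQ : ((t : ℝ) - √((b : ℝ) * c)) ^ (2 * p) ≤ (4 * ((b : ℝ) * c)) ^ p := by
    rw [pow_mul]
    gcongr
    nlinarith
  have hP0 : 0 ≤ ((t : ℝ) + √((b : ℝ) * c)) ^ (2 * p) := by positivity
  have hQ0 : 0 ≤ ((t : ℝ) - √((b : ℝ) * c)) ^ (2 * p) := by rw [pow_mul]; positivity
  have hb' : 0 < √(b : ℝ) := by positivity
  have hc' : 0 < √(c : ℝ) := by positivity
  have hr0 : (0 : ℝ) ≤ r := Nat.cast_nonneg r
  have hcoef : ∀ σ : ℝ, σ ≤ 1 →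
      ((s : ℝ) * √(b : ℝ) + σ * r * √(c : ℝ)) / (2 * √(b : ℝ)) ≤ √(c : ℝ) := by
    intro σ hσ
    rw [div_le_iff₀ (by positivity)]
    have h1 : (s : ℝ) * √(b : ℝ) ≤ √(c : ℝ) * √(b : ℝ) := by gcongr
    have h2 : σ * r * √(c : ℝ) ≤ 1 * √(b : ℝ) * √(c : ℝ) := by
      gcongr
    linarith
  have h1 := hcoef ρ (by rcases hρ with rfl | rfl <;> norm_num)
  have h2 := hcoef (-ρ) (by rcases hρ with rfl | rfl <;> norm_num)
  rw [seqW]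
  have e1 := mul_le_mul h1 hP hP0 hc'.le
  have e2 := mul_le_mul h2 hQ hQ0 hc'.le
  rw [neg_mul, neg_mul, ← sub_eq_add_neg] at e2
  linarith

theorem le_two_mul_of_seqV_eq_seqW {b c r s t m n : ℕ} {ρ : ℤ} (hb : 1 < b) (hbc : b < c)
    (hr : b = r ^ 2 + 1) (hs : c = s ^ 2 + 1) (ht : b * c = t ^ 2 + 1) (hρ : ρ = 1 ∨ ρ = -1)
    (h : seqV c s m = seqW b c r s t ρ n) : m ≤ 2 * n := by
  by_contra! hm
  have hle := (le_seqV hs m).trans (h.le.trans (seqW_le (by omega) (by omega) hr hs ht hρ n))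
  have hs2 : 2 ≤ s := by
    by_contra! hs2
    interval_cases s <;> omega
  have hs1 : (1 : ℝ) < s := by exact_mod_cast hs2
  have hc : (c : ℝ) = s ^ 2 + 1 := by exact_mod_cast hs
  have hbc' : (b : ℝ) ≤ c := by exact_mod_cast hbc.le
  have hsq : √(c : ℝ) < s ^ 3 := by
    rw [Real.sqrt_lt' (by positivity), hc]
    have h2 : (1 : ℝ) < s ^ 2 := by nlinarith
    have h4 : (s : ℝ) ^ 2 < s ^ 4 := by nlinarith
    have h3 : (2 : ℝ) ≤ s := by exact_mod_cast hs2
    nlinarith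
  have hlow : (4 * (s : ℝ) ^ 2) ^ (2 * n + 1) ≤ (4 * (s : ℝ) ^ 2) ^ m :=
    pow_le_pow_right₀ (by nlinarith) hm
  have hup : (4 * ((b : ℝ) * c)) ^ n ≤ ((4 * (s : ℝ) ^ 2) ^ 2) ^ n := by
    gcongr
    have : (c : ℝ) ≤ 2 * s ^ 2 := by nlinarith
    have h5 : (b : ℝ) * c ≤ (2 * s ^ 2) * (2 * s ^ 2) := by
      apply mul_le_mul <;> first | positivity | linarith
    nlinarith
  rw [← pow_mul] at hup
  have hX : 0 < (4 * (s : ℝ) ^ 2) ^ (2 * n) := by positivity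
  have h6 : 2 * √(c : ℝ) * (4 * ((b : ℝ) * c)) ^ n < 2 * (s : ℝ) ^ 3 * (4 * (s : ℝ) ^ 2) ^ (2 * n) := by
    calc _ ≤ 2 * √(c : ℝ) * (4 * (s : ℝ) ^ 2) ^ (2 * n) := by gcongr
      _ < _ := by gcongr
  have h7 : 2 * (s : ℝ) ^ 3 * (4 * (s : ℝ) ^ 2) ^ (2 * n) ≤ s / 2 * (4 * (s : ℝ) ^ 2) ^ m := by
    calc _ = s / 2 * (4 * (s : ℝ) ^ 2) ^ (2 * n + 1) := by ring
      _ ≤ _ := by gcongr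
  linarith

/-! ### Vieta jumping and size estimates for `f` and `S = 2fr - s`. -/

section Descent

variable {b c r s f n : ℤ}

/-- If `f ≥ r`, the equation forces `2r² ≤ 2fr ≤ s`, hence `b² ≤ c`, too large for `c ^ 5 < b ^ 7`.
-/
theorem lt_of_sq_add_eq (hr0 : 0 < r) (hs0 : 0 < s) (hf0 : 0 < f) (hr : b = r ^ 2 + 1)
    (hs : c = s ^ 2 + 1) (hq : f ^ 2 + 2 * f * r * s = r ^ 2 + s ^ 2)
    (h7 : c ^ 5 < b ^ 7) : f < r := by
  by_contra! h
  have h1 : 2 * f * r ≤ s := by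
    by_contra! h2
    nlinarith
  have h2 : 2 * r ^ 2 ≤ s := by nlinarith
  have h3 : b ^ 2 ≤ c := by
    rw [hr, hs]
    have : (2 * r ^ 2) ^ 2 ≤ s ^ 2 := by gcongr
    nlinarith [sq_nonneg (r ^ 2 - 1), sq_nonneg r]
  have hb : 1 ≤ b := by nlinarith
  have h4 : (b ^ 2) ^ 5 ≤ c ^ 5 := by gcongr
  have h5 : b ^ 7 ≤ b ^ 10 := pow_le_pow_right₀ hb (by norm_num)
  nlinarith

/-- As a quadratic in `s`, the equation has second root `2fr - s`, and the product of the roots is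
`r² - f²`. -/
theorem mul_lt_of_sq_add_eq (hrs : r < s) (hf0 : 0 < f) (hfr : f < r)
    (hq : f ^ 2 + 2 * f * r * s = r ^ 2 + s ^ 2) : 
    0 < 2 * f * r - s ∧ f * r < s ∧ f * (2 * f * r - s) < r := by
  have h1 : (2 * f * r - s) * s = r ^ 2 - f ^ 2 := by linear_combination hq
  have h2 : 0 < 2 * f * r - s := by
    by_contra! h
    nlinarith
  have h3 : 2 * f * r - s < r := by
    by_contra! h
    nlinarith
  have h4 : f * r < s := by linarith
  refine ⟨h2, h4, ?_⟩
  by_contra! h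
  nlinarith

theorem sq_lt_of_pow_four_mul_lt (hrs : r < s) (hf0 : 0 < f) (hfr : f < r)
    (hr : b = r ^ 2 + 1) (hs : c = s ^ 2 + 1) (hq : f ^ 2 + 2 * f * r * s = r ^ 2 + s ^ 2)
    (hn : 0 < n) (h : n ^ 4 * c < 16 * b ^ 2) : n ^ 2 < 4 * (2 * f * r - s) + 4 := by
  obtain ⟨hS, hfrs, -⟩ := mul_lt_of_sq_add_eq hrs hf0 hfr hq
  have h1 : (2 * f * r - s) * s = r ^ 2 - f ^ 2 := by linear_combination hq
  have hs0 : 0 < s := by linarith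
  have h2 : n ^ 2 * s < 4 * b := by
    apply lt_of_pow_lt_pow_left₀ 2 (by nlinarith)
    calc (n ^ 2 * s) ^ 2 = n ^ 4 * s ^ 2 := by ring
      _ ≤ n ^ 4 * c := by gcongr; linarith
      _ < _ := by linarith
  have h3 : f ^ 2 + 1 ≤ s := by nlinarith
  by_contra! h4
  have h5 : (4 * (2 * f * r - s) + 4) * s ≤ n ^ 2 * s := by gcongr
  nlinarith

theorem le_four_mul_sq_mul (hs0 : 0 < s)
    (hr : b = r ^ 2 + 1) (hs : c = s ^ 2 + 1) (hS : 0 < 2 * f * r - s) :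
    c ≤ 4 * f ^ 2 * b := by
  have : s ^ 2 < (2 * f * r) ^ 2 := by
    gcongr; linarith
  rw [hr, hs]
  nlinarith [sq_nonneg f]

/-- If `f ≤ 5`, then `c ≤ 100b`, so `b ^ 29 ≤ c ^ 25` bounds `b`, whereas `n ≥ 1000` forces `b` to
be larger. -/
theorem six_le_of_pow_le (hb0 : 0 < b) (hc0 : 0 < c) (hf0 : 0 < f) (hcb : c ≤ 4 * f ^ 2 * b)
    (h29 : b ^ 29 ≤ c ^ 25) (hn : 1000 ≤ n) (h : n ^ 4 * c < 16 * b ^ 2) : 6 ≤ f := by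
  by_contra! hf
  have hcb' : c ≤ 100 * b := by
    have : f ^ 2 ≤ 5 ^ 2 := by gcongr; omega
    nlinarith
  have h1 : b ^ 4 ≤ 100 ^ 25 := by
    have h2 : c ^ 25 ≤ (100 * b) ^ 25 := by gcongr
    rw [mul_pow] at h2
    have h3 : b ^ 25 * b ^ 4 ≤ b ^ 25 * 100 ^ 25 := by
      calc b ^ 25 * b ^ 4 = b ^ 29 := by ring
        _ ≤ c ^ 25 := h29
        _ ≤ 100 ^ 25 * b ^ 25 := h2
        _ = _ := mul_comm _ _
    exact le_of_mul_le_mul_left h3 (by positivity)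
  have h4 : b ≤ 4 * 10 ^ 12 := by
    by_contra! h5
    have : (4 * 10 ^ 12) ^ 4 < b ^ 4 := by gcongr
    norm_num at this h1
    linarith
  have h6 : (n ^ 4 * c) ^ 25 < (16 * b ^ 2) ^ 25 := by gcongr
  have h7 : (1000 : ℤ) ^ 100 * b ^ 29 < 16 ^ 25 * b ^ 21 * b ^ 29 := by
    calc (1000 : ℤ) ^ 100 * b ^ 29 ≤ n ^ 100 * c ^ 25 := by gcongr
      _ = (n ^ 4 * c) ^ 25 := by ring
      _ < _ := h6
      _ = _ := by ring
  have h8 := lt_of_mul_lt_mul_right h7 (by positivity)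
  have h9 : (16 : ℤ) ^ 25 * b ^ 21 ≤ 16 ^ 25 * (4 * 10 ^ 12) ^ 21 := by gcongr
  norm_num at h8 h9
  linarith

/-- Heuristically `S ≈ r²/s` and `f ≈ s/(2r)`, so the claim compares `s ^ 7` with `r ^ 10`; `c ^ 5 <
b ^ 7` gives roughly `s ^ 7 < r ^ 9.8`. Any constant above 16 serves in `two_mul_mul_sq_lt`. -/
theorem seventeen_mul_pow_four_lt (hrs : r < s) (hfr : f < r) (hf : 6 ≤ f)
    (hr : b = r ^ 2 + 1) (hs : c = s ^ 2 + 1) (hq : f ^ 2 + 2 * f * r * s = r ^ 2 + s ^ 2)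
    (hS : 1000 ≤ 2 * f * r - s) (h7 : c ^ 5 < b ^ 7) :
    17 * f ^ 4 < (2 * f * r - s) ^ 3 := by
  obtain ⟨hS0, hfrs, hfS⟩ := mul_lt_of_sq_add_eq hrs (by linarith) hfr hq
  have h1 : (2 * f * r - s) * s = r ^ 2 - f ^ 2 := by linear_combination hq
  have h2s : 3 * (f * r) ≤ 2 * s := by nlinarith
  set S := 2 * f * r - s
  have hr0 : 0 < r := by linarith
  have hs0 : 0 < s := by linarith
  have hf1000 : 1000 * f < r := by nlinarith
  have h4 : 4 * s ^ 7 < r ^ 10 := by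
    by_contra! h
    have e1 : (r ^ 10) ^ 10 ≤ (4 * s ^ 7) ^ 10 := by gcongr
    have e2 : s ^ 10 < b ^ 7 := by
      calc s ^ 10 = (s ^ 2) ^ 5 := by ring
        _ ≤ c ^ 5 := by gcongr; linarith
        _ < _ := h7
    have e3 : 1000 * b ≤ 1001 * r ^ 2 := by nlinarith
    have e4 : (1000 * b) ^ 49 ≤ (1001 * r ^ 2) ^ 49 :=
      pow_le_pow_left₀ (by rw [hr]; positivity) e3 49
    have e5 : (s ^ 10) ^ 7 ≤ (b ^ 7) ^ 7 := by gcongr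
    -- The spare `r²` beats `4 ^ 10 * (1001 / 1000) ^ 49`.
    have e6 : (10 ^ 7 : ℤ) * r ^ 98 ≤ r ^ 100 := by
      rw [show r ^ 100 = r ^ 2 * r ^ 98 by ring]
      gcongr
      have : 6000 ≤ r := by linarith
      nlinarith
    have e7 : r ^ 100 ≤ 4 ^ 10 * b ^ 49 := by
      calc r ^ 100 = (r ^ 10) ^ 10 := by ring
        _ ≤ _ := e1
        _ = 4 ^ 10 * (s ^ 10) ^ 7 := by ring
        _ ≤ 4 ^ 10 * (b ^ 7) ^ 7 := by gcongr
        _ = _ := by ring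
    have e8 : 0 < r ^ 98 := by positivity
    have e9 : (1001 * r ^ 2) ^ 49 = 1001 ^ 49 * r ^ 98 := by ring
    rw [e9, mul_pow] at e4
    norm_num at e4 e6 e7
    linarith
  have h5 : (99 : ℤ) * r ^ 6 ≤ 100 * (r ^ 2 - f ^ 2) ^ 3 := by
    have e1 : 1000000 * f ^ 2 ≤ r ^ 2 := by nlinarith
    have e2 : 0 ≤ 999999 * r ^ 2 := by positivity
    have e3 : (999999 * r ^ 2) ^ 3 ≤ (1000000 * (r ^ 2 - f ^ 2)) ^ 3 := by
      exact pow_le_pow_left₀ e2 (by linarith) 3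
    have e4 : 0 < r ^ 6 := by positivity
    ring_nf at e3 ⊢
    linarith
  have h6 : (3 * (f * r)) ^ 4 ≤ (2 * s) ^ 4 := by gcongr
  have h8 : 17 * f ^ 4 * (r ^ 4 * s ^ 3) < S ^ 3 * (r ^ 4 * s ^ 3) := by
    have e1 : (3 * (f * r)) ^ 4 * s ^ 3 ≤ (2 * s) ^ 4 * s ^ 3 := by gcongr
    have e2 : (99 * r ^ 6) * r ^ 4 ≤ (100 * (r ^ 2 - f ^ 2) ^ 3) * r ^ 4 := by gcongr
    have e3 : S ^ 3 * (r ^ 4 * s ^ 3) = (r ^ 2 - f ^ 2) ^ 3 * r ^ 4 := by rw [← h1]; ring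
    have e4 : 0 < s ^ 7 := by positivity
    rw [e3]
    ring_nf at e1 e2 h4 ⊢
    linarith
  exact lt_of_mul_lt_mul_right h8 (by positivity)

theorem descent_step {x y A A' E : ℤ} (h : y ^ 2 * A - x ^ 2 * A' = E) (hE : |E| < y ^ 2)
    (hA : 1 ≤ A) (hxy : 2 * y ^ 2 ≤ x ^ 2) : 1 ≤ A' ∧ A' < A := by
  obtain ⟨h1, h2⟩ := abs_lt.mp hE
  have hy : 0 < y ^ 2 := (abs_nonneg E).trans_lt hE
  constructor
  · by_contra! h3
    nlinarith
  · by_contra! h3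
    nlinarith

theorem descent_le {x y A A' E : ℤ} (h : y ^ 2 * A - x ^ 2 * A' = E) (hE : |E| < y ^ 2)
    (hy : 0 ≤ y) (hf : 0 ≤ f) (hA' : 1 ≤ A') (hxy : f * y ≤ x) : f ^ 2 * A' ≤ A := by
  obtain ⟨h1, h2⟩ := abs_lt.mp hE
  have hxy' : (f * y) ^ 2 ≤ x ^ 2 := by gcongr
  have hy : 0 < y ^ 2 := (abs_nonneg E).trans_lt hE
  by_contra! h3
  have h4 : y ^ 2 * (A + 1) ≤ y ^ 2 * (f ^ 2 * A') := by
    gcongr; omega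
  nlinarith

end Descent

/-! ### Bounds on quotients and discrepancies, and the terminal case. -/

section Descent

variable {b c r s f S T m n q ρ K₁ K₂ : ℤ}

theorem quotient_bounds (hr : b = r ^ 2 + 1) (hs : c = s ^ 2 + 1)
    (hfr : f < r) (hf : 6 ≤ f) (hfrs : f * r < s)
    (hρ : ρ = 1 ∨ ρ = -1) (hn : 1000 ≤ n) (hnr : n ^ 2 < r) (hm0 : 0 ≤ m) (hm : m ≤ 2 * n)
    (h : 2 * (b * n ^ 2 - m ^ 2) + ρ * n * (b + f ^ 2) = c * q) :
    1 ≤ q ∧ f ^ 2 * q ≤ 3 * n ^ 2 := by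
  have hm2 : m ^ 2 ≤ 4 * n ^ 2 := by nlinarith
  have hr0 : 0 < r := by linarith
  have hs0 : 0 < s := by nlinarith
  have hf2 : f ^ 2 ≤ r ^ 2 := by gcongr
  have hnf : n * f ^ 2 ≤ n * r ^ 2 := by gcongr
  have hn2 : 1000 * n ≤ n ^ 2 := by nlinarith
  have hnr2 : n * r ^ 2 * 1000 ≤ n ^ 2 * r ^ 2 := by nlinarith [sq_nonneg r]
  have hr2 : 1000000 ≤ r ^ 2 := by nlinarith
  have hn2r : 1000000 * n ^ 2 ≤ n ^ 2 * r ^ 2 := by nlinarith [sq_nonneg n]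
  have hfrs2 : (f * r) ^ 2 ≤ s ^ 2 := by gcongr
  have hpos : 0 < c * q := by
    rw [← h, hr]
    rcases hρ with rfl | rfl <;> nlinarith
  have hq1 : 1 ≤ q := by
    by_contra! h1
    nlinarith
  refine ⟨hq1, ?_⟩
  have h1 : (f * r) ^ 2 * q ≤ s ^ 2 * q := by gcongr
  have h2 : s ^ 2 * q ≤ 3 * n ^ 2 * r ^ 2 := by
    have e1 : s ^ 2 * q = 2 * ((r ^ 2 + 1) * n ^ 2 - m ^ 2) + ρ * n * (r ^ 2 + 1 + f ^ 2) - q := by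
      rw [← hr, h, hs]; ring
    have hm3 : 0 ≤ m ^ 2 := by positivity
    rcases hρ with rfl | rfl <;> nlinarith
  have h3 : (f ^ 2 * q) * r ^ 2 ≤ (3 * n ^ 2) * r ^ 2 := by nlinarith
  exact le_of_mul_le_mul_right h3 (by positivity)

theorem abs_discrepancy_le (hρ : ρ = 1 ∨ ρ = -1) (hn : 1000 ≤ n) (hm0 : 0 ≤ m)
    (hm : m ≤ 2 * n) (hf : 6 ≤ f) (hq1 : 1 ≤ q) (hfq : f ^ 2 * q ≤ 3 * n ^ 2) :
    |2 * (m ^ 2 - n ^ 2) - ρ * n * (1 + f ^ 2) + q + 2 * f ^ 2 * q| ≤ 13 * n ^ 2 + n * f ^ 2 := by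
  have hm2 : m ^ 2 ≤ 4 * n ^ 2 := by nlinarith
  have hm3 : 0 ≤ m ^ 2 := by positivity
  have h1 : 0 ≤ n * f ^ 2 := by positivity
  have h2 : 36 * q ≤ f ^ 2 * q := by
    gcongr
    nlinarith
  rw [abs_le]
  constructor <;> rcases hρ with rfl | rfl <;> nlinarith

theorem two_mul_mul_sq_lt (hn : 0 < n) (hnS : n ^ 2 < 4 * S + 4) (hS : 1000 ≤ S)
    (h17 : 17 * f ^ 4 < S ^ 3) : 2 * (n * f ^ 2) < S ^ 2 := by
  apply lt_of_pow_lt_pow_left₀ 2 (by positivity)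
  have h1 : n ^ 2 * (17 * f ^ 4) < (4 * S + 4) * S ^ 3 := by
    apply mul_lt_mul'' hnS h17 <;> positivity
  have h2 : 16 * S ^ 3 ≤ S ^ 4 := by
    have : 0 < S ^ 3 := by positivity
    nlinarith
  nlinarith

/-- In the second descent step the square of the new term dominates the discrepancy. -/
theorem eighteen_mul_sq_lt (hS : 250000 ≤ S) (hT : 0 < T) (hrT : r * T = S ^ 2 - f ^ 2)
    (hTr : T = 2 * f * S - r) (hf : 0 < f) (hn : 0 < n) (hnS : n ^ 2 < 4 * S + 4)
    (hfn : 4 * f ^ 2 ≤ 3 * n) : 18 * n ^ 2 < T ^ 2 := by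
  by_contra! h
  have hf4 : (4 * f ^ 2) ^ 2 ≤ (3 * n) ^ 2 := by gcongr
  have hfS : f ^ 2 ≤ S := by
    by_contra! h
    nlinarith
  -- Since `r < 2fS`, the product `rT = S² - f²` bounds `T` below by about `S/(2f)`.
  have h1 : S ^ 2 - S ≤ 2 * f * S * T := by nlinarith
  have h2 : (S * (S - 1)) ^ 2 ≤ (2 * f * S * T) ^ 2 := by
    apply pow_le_pow_left₀ (by nlinarith)
    linarith
  have h3 : (S - 1) ^ 2 ≤ 4 * f ^ 2 * T ^ 2 := by
    have : S ^ 2 * (S - 1) ^ 2 ≤ S ^ 2 * (4 * f ^ 2 * T ^ 2) := by nlinarith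
    exact le_of_mul_le_mul_left this (by positivity)
  have h4 : 4 * f ^ 2 * T ^ 2 ≤ (3 * n) * (18 * n ^ 2) := by gcongr
  have h5 : ((S - 1) ^ 2) ^ 2 ≤ (54 * n ^ 3) ^ 2 := by
    gcongr
    linarith
  have h6 : (n ^ 2) ^ 3 ≤ (4 * S + 4) ^ 3 := by gcongr
  -- A quartic bounded by a cubic: impossible for `S ≥ 250000`.
  have h7 : (S - 1) ^ 4 ≤ 2916 * 64 * (S + 1) ^ 3 := by nlinarith
  obtain ⟨u, rfl⟩ : ∃ u, S = u + 250000 := ⟨S - 250000, by ring⟩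
  have hu : 0 ≤ u := by linarith
  have h8 : 0 ≤ u ^ 2 := by positivity
  have h9 : 0 ≤ u ^ 3 := by positivity
  have h10 : 0 ≤ u ^ 4 := by positivity
  ring_nf at h7
  linarith

/-- An index `n` with `n ^ 4 * c < 16 * b ^ 2` reaches a positive third quotient `K₂` only if
`f < 9` and `K₂ = 1`. -/
theorem final_power_bound (hr1 : 0 < b) (hK : 1 ≤ K₂) (hf : 6 ≤ f) (hn : 1000 ≤ n)
    (hcb : c ≤ 4 * f ^ 2 * b) (hbc : (4 * f ^ 2 - 3) * b ≤ c) (h29 : b ^ 29 ≤ c ^ 25)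
    (h : n ^ 4 * c < 16 * b ^ 2) (hP : (4 * f ^ 2 - 3) ^ 3 * K₂ ≤ 2 * n ^ 2 + n) :
    f < 9 ∧ K₂ = 1 := by
  have hf2 : 36 ≤ f ^ 2 := by nlinarith
  have hc0 : 0 < c := by nlinarith
  have h1 : b ^ 4 ≤ (4 * f ^ 2) ^ 25 := by
    have h2 : c ^ 25 ≤ (4 * f ^ 2 * b) ^ 25 := by gcongr
    rw [mul_pow _ b] at h2
    have h3 : b ^ 25 * b ^ 4 ≤ b ^ 25 * (4 * f ^ 2) ^ 25 := by
      calc b ^ 25 * b ^ 4 = b ^ 29 := by ring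
        _ ≤ c ^ 25 := h29
        _ ≤ _ := h2
        _ = _ := mul_comm _ _
    exact le_of_mul_le_mul_left h3 (by positivity)
  obtain ⟨y, hy⟩ : ∃ y, y = 4 * f ^ 2 - 3 := ⟨_, rfl⟩
  have hy0 : 141 ≤ y := by linarith
  rw [← hy] at hbc hP
  rw [show 4 * f ^ 2 = y + 3 by linarith] at h1
  have h2 : n ^ 4 * y < 16 * b := by
    have : n ^ 4 * y * b < 16 * b * b := by
      calc n ^ 4 * y * b = n ^ 4 * (y * b) := by ring
        _ ≤ n ^ 4 * c := by gcongr
        _ < _ := h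
        _ = _ := by ring
    exact lt_of_mul_lt_mul_right this hr1.le
  have h3 : (n ^ 4 * y) ^ 4 ≤ (16 * b) ^ 4 := by gcongr
  have h4 : n ^ 16 * y ^ 4 ≤ 65536 * (y + 3) ^ 25 := by
    calc n ^ 16 * y ^ 4 = (n ^ 4 * y) ^ 4 := by ring
      _ ≤ _ := h3
      _ = 65536 * b ^ 4 := by ring
      _ ≤ _ := by gcongr
  have h5 : 1000 * (y ^ 3 * K₂) ≤ 2001 * n ^ 2 := by nlinarith
  have h6 : (1000 * (y ^ 3 * K₂)) ^ 8 ≤ (2001 * n ^ 2) ^ 8 := by gcongr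
  have h7 : 1000 ^ 8 * (y ^ 28 * K₂ ^ 8) ≤ 2001 ^ 8 * (65536 * (y + 3) ^ 25) := by
    calc 1000 ^ 8 * (y ^ 28 * K₂ ^ 8) = (1000 * (y ^ 3 * K₂)) ^ 8 * y ^ 4 := by ring
      _ ≤ (2001 * n ^ 2) ^ 8 * y ^ 4 := by gcongr
      _ = 2001 ^ 8 * (n ^ 16 * y ^ 4) := by ring
      _ ≤ _ := by gcongr
  have h8 : 141 ^ 25 * (y + 3) ^ 25 ≤ 144 ^ 25 * y ^ 25 := by
    rw [← mul_pow, ← mul_pow]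
    gcongr ?_ ^ 25
    linarith
  have h9 : 1000 ^ 8 * 141 ^ 25 * (y ^ 3 * K₂ ^ 8) ≤ 2001 ^ 8 * 65536 * 144 ^ 25 := by
    have : (1000 ^ 8 * 141 ^ 25 * (y ^ 3 * K₂ ^ 8)) * y ^ 25 ≤
        (2001 ^ 8 * 65536 * 144 ^ 25) * y ^ 25 := by
      calc _ = 141 ^ 25 * (1000 ^ 8 * (y ^ 28 * K₂ ^ 8)) := by ring
        _ ≤ 141 ^ 25 * (2001 ^ 8 * (65536 * (y + 3) ^ 25)) := by gcongr
        _ = 2001 ^ 8 * 65536 * (141 ^ 25 * (y + 3) ^ 25) := by ring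
        _ ≤ 2001 ^ 8 * 65536 * (144 ^ 25 * y ^ 25) := by gcongr
        _ = _ := by ring
    exact le_of_mul_le_mul_right this (by positivity)
  -- `321 = 4 * 9² - 3` and `141 = 4 * 6² - 3` are the values of `y` at `f = 9` and `f = 6`.
  have h10 : y ^ 3 * K₂ ^ 8 < 321 ^ 3 := by
    by_contra! h11
    norm_num at h9 h11
    linarith
  constructor
  · by_contra! hf9
    have hy1 : 321 ≤ y := by nlinarith
    have h11 : 321 ^ 3 ≤ y ^ 3 := by gcongr
    have h12 : 1 ≤ K₂ ^ 8 := one_le_pow₀ hK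
    nlinarith
  · by_contra! h11
    have h12 : 2 ^ 8 ≤ K₂ ^ 8 := by
      gcongr
      omega
    have h13 : 141 ^ 3 * 2 ^ 8 ≤ y ^ 3 * K₂ ^ 8 := by gcongr
    norm_num at h10 h13
    linarith

/-- For each `f` the right side falls in a gap between `2k² + k` and `2(k+1)² - (k+1)`. -/
theorem two_mul_sq_add_ne (hρ : ρ = 1 ∨ ρ = -1) (hf : 6 ≤ f) (hf9 : f < 9) (hn : 0 < n) :
    2 * n ^ 2 + ρ * n ≠ (4 * f ^ 2 - 2) ^ 3 - 2 * (4 * f ^ 2 - 2) := by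
  intro h
  have key : ∀ k : ℤ, 2 * k ^ 2 + k < 2 * n ^ 2 + ρ * n →
      2 * n ^ 2 + ρ * n < 2 * (k + 1) ^ 2 - (k + 1) → 0 ≤ k → False := by
    intro k h1 h2 hk
    have h3 : k < n := by
      by_contra! h3
      rcases hρ with rfl | rfl <;> nlinarith
    have h4 : n < k + 1 := by
      by_contra! h4
      rcases hρ with rfl | rfl <;> nlinarith
    omega
  obtain rfl | rfl | rfl : f = 6 ∨ f = 7 ∨ f = 8 := by omega
  · exact key 1196 (by rw [h]; norm_num) (by rw [h]; norm_num) (by norm_num)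
  · exact key 1910 (by rw [h]; norm_num) (by rw [h]; norm_num) (by norm_num)
  · exact key 2862 (by rw [h]; norm_num) (by rw [h]; norm_num) (by norm_num)

end Descent

/-! ### The descent itself. -/

section Descent

variable {b c r s t f m n ρ x y A A' E : ℤ}

/-- With `X = 2fy - x`, Vieta gives `X² + x² = (4f² - 2)y² + 2f²`. -/
theorem descent_next (hq : f ^ 2 + 2 * f * x * y = x ^ 2 + y ^ 2)
    (h : y ^ 2 * A - x ^ 2 * A' = E) :
    (2 * f * y - x) ^ 2 * A' - y ^ 2 * ((4 * f ^ 2 - 2) * A' - A) = E + 2 * f ^ 2 * A' := by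
  linear_combination h - 2 * A' * hq

set_option maxHeartbeats 1000000 in
/-- The index bound, in integers and with a uniform constant. -/
theorem sixteen_mul_sq_le (hr0 : 0 < r) (hrs : r < s) (hf0 : 0 < f) (hr : b = r ^ 2 + 1)
    (hs : c = s ^ 2 + 1) (hq : f ^ 2 + 2 * f * r * s = r ^ 2 + s ^ 2)
    (h7 : c ^ 5 < b ^ 7) (h29 : b ^ 29 ≤ c ^ 25) (hρ : ρ = 1 ∨ ρ = -1) (hn : 1000 ≤ n)
    (hm0 : 0 ≤ m) (hm : m ≤ 2 * n)
    (hdvd : c ∣ 2 * (b * n ^ 2 - m ^ 2) + ρ * n * (b + f ^ 2)) :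
    16 * b ^ 2 ≤ n ^ 4 * c := by
  by_contra! hcon
  have hs0 : 0 < s := by linarith
  have hb0 : 0 < b := by rw [hr]; positivity
  have hc0 : 0 < c := by rw [hs]; positivity
  have hfr := lt_of_sq_add_eq hr0 hs0 hf0 hr hs hq h7
  obtain ⟨hS0, hfrs, hfS⟩ := mul_lt_of_sq_add_eq hrs hf0 hfr hq
  have hnS := sq_lt_of_pow_four_mul_lt hrs hf0 hfr hr hs hq (by linarith) hcon
  have hcb := le_four_mul_sq_mul hs0 hr hs hS0
  have hf := six_le_of_pow_le hb0 hc0 hf0 hcb h29 hn hcon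
  have hn2 : 1000000 ≤ n ^ 2 := by nlinarith
  have h17 := seventeen_mul_pow_four_lt hrs hfr hf hr hs hq (by linarith) h7
  have hceq : c = (4 * f ^ 2 - 2) * b - (2 * f * r - s) ^ 2 + 3 - 2 * f ^ 2 := by
    rw [hr, hs]; linear_combination (-2) * hq
  have hq1 : f ^ 2 + 2 * f * (2 * f * r - s) * r = (2 * f * r - s) ^ 2 + r ^ 2 := by
    linear_combination hq
  obtain ⟨q, hX⟩ := hdvd
  have e0 : (2 * f * r - s) ^ 2 * q - r ^ 2 * ((4 * f ^ 2 - 2) * q - (2 * n ^ 2 + ρ * n)) =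
      2 * (m ^ 2 - n ^ 2) - ρ * n * (1 + f ^ 2) + q + 2 * f ^ 2 * q := by
    linear_combination hX + q * hs - (2 * n ^ 2 + ρ * n) * hr - 2 * q * hq
  generalize 2 * f * r - s = S at *
  -- From `10 ^ 6 ≤ n² < 4S + 4`.
  have hS : 250000 ≤ S := by omega
  have h6S : 6 * S ≤ f * S := by gcongr
  have hnr : n ^ 2 < r := by linarith
  obtain ⟨hq_pos, hfq⟩ := quotient_bounds hr hs hfr hf hfrs hρ hn hnr hm0 hm hX
  have hE0 := abs_discrepancy_le hρ hn hm0 hm hf hq_pos hfq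
  have hnf := two_mul_mul_sq_lt (by linarith) hnS (by linarith) h17
  have hfS' : f < S := by
    by_contra! h
    have : S ^ 3 ≤ f ^ 3 := by gcongr
    have : f ^ 4 = f * f ^ 3 := by ring
    have : 1 * f ^ 3 ≤ f * f ^ 3 := by gcongr; linarith
    linarith [pow_pos hf0 3]
  have hSr : S < r := by linarith
  obtain ⟨hT0, -, hfT⟩ := mul_lt_of_sq_add_eq hSr hf0 hfS' (by linear_combination hq1)
  have hbc : (4 * f ^ 2 - 3) * b ≤ c := by
    have : f ^ 2 < S ^ 2 := by gcongr
    have : (6 * S) ^ 2 ≤ r ^ 2 := by gcongr; linarith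
    linarith
  have hρn : ρ * n ≤ n := by rcases hρ with rfl | rfl <;> linarith
  have hf2 : 6 ^ 2 ≤ f ^ 2 := by gcongr
  have h36q : 36 * q ≤ f ^ 2 * q := by gcongr; linarith
  -- the first quotient
  set E₀ := 2 * (m ^ 2 - n ^ 2) - ρ * n * (1 + f ^ 2) + q + 2 * f ^ 2 * q
  have hSS : 250000 * S ≤ S ^ 2 := by rw [sq]; gcongr
  have hE0S : |E₀| < S ^ 2 := hE0.trans_lt (by linarith)
  have h6S2 : (6 * S) ^ 2 ≤ r ^ 2 := by gcongr; linarith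
  obtain ⟨hK1, hK1q⟩ := descent_step e0 hE0S hq_pos (by linarith)
  have hfK1 := descent_le e0 hE0S hS0.le hf0.le hK1 hfS.le
  have e1 := descent_next (f := f) (x := r) (y := S) (by linear_combination hq1) e0
  obtain ⟨K₁, hK₁⟩ : ∃ K, K = (4 * f ^ 2 - 2) * q - (2 * n ^ 2 + ρ * n) := ⟨_, rfl⟩
  rw [← hK₁] at hK1 hK1q hfK1 e1
  have hfn : 4 * f ^ 2 ≤ 3 * n := by
    by_contra! h
    have g1 : f ^ 2 * 1 ≤ q := le_trans (by gcongr) hfK1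
    rw [mul_one] at g1
    have g2 : (4 * f ^ 2 - 3) * f ^ 2 ≤ (4 * f ^ 2 - 3) * q := by gcongr; linarith
    have g3 : (3 * n) * (4 * f ^ 2) ≤ (4 * f ^ 2) * (4 * f ^ 2) := by gcongr
    have g4 : (3 * n) * (3 * n) ≤ (3 * n) * (4 * f ^ 2) := by gcongr
    linarith
  have hrT : r * (2 * f * S - r) = S ^ 2 - f ^ 2 := by linear_combination hq1
  -- the second quotient
  have hq2 : f ^ 2 + 2 * f * (2 * f * S - r) * S = (2 * f * S - r) ^ 2 + S ^ 2 := by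
    linear_combination hq1
  have hT18 := eighteen_mul_sq_lt hS hT0 hrT rfl hf0 (by linarith) hnS hfn
  generalize 2 * f * S - r = T at *
  have hnf4 : 4 * (n * f ^ 2) ≤ 3 * n ^ 2 := by
    have : n * (4 * f ^ 2) ≤ n * (3 * n) := by gcongr
    linarith
  have hE1 : |E₀ + 2 * f ^ 2 * K₁| ≤ 14 * n ^ 2 := by
    rw [abs_le] at hE0 ⊢
    have : 0 ≤ f ^ 2 * K₁ := by positivity
    constructor <;> linarith
  have h6T : 6 * T ≤ f * T := by gcongr
  have h6T2 : (6 * T) ^ 2 ≤ S ^ 2 := by gcongr; linarith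
  have hE1T : |E₀ + 2 * f ^ 2 * K₁| < T ^ 2 := by linarith
  obtain ⟨hK2, hK2K1⟩ := descent_step e1 hE1T hK1 (by linarith)
  have hfK2 := descent_le e1 hE1T hT0.le hf0.le hK2 hfT.le
  have e2 := descent_next (f := f) (x := S) (y := T) (by linear_combination hq2) e1
  obtain ⟨K₂, hK₂⟩ : ∃ K, K = (4 * f ^ 2 - 2) * K₁ - q := ⟨_, rfl⟩
  rw [← hK₂] at hK2 hK2K1 hfK2 e2
  -- the third quotient
  have hE2 : |E₀ + 2 * f ^ 2 * K₁ + 2 * f ^ 2 * K₂| ≤ 15 * n ^ 2 := by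
    rw [abs_le] at hE1 ⊢
    have : 0 ≤ f ^ 2 * K₂ := by positivity
    constructor <;> linarith
  have hfT' : f < T := by
    by_contra! h
    have : T ^ 2 ≤ f ^ 2 := by gcongr
    have : 1000 * n ≤ n ^ 2 := by rw [sq]; gcongr
    linarith
  obtain ⟨hU0, -, hfU⟩ := mul_lt_of_sq_add_eq (r := T) (s := S) (by linarith) hf0 hfT'
    (by linear_combination hq2)
  generalize 2 * f * T - S = U at *
  have h6U : 6 * U ≤ f * U := by gcongr
  have h6U2 : (6 * U) ^ 2 ≤ T ^ 2 := by gcongr; linarith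
  obtain ⟨K₃, hK₃⟩ : ∃ K, K = (4 * f ^ 2 - 2) * K₂ - K₁ := ⟨_, rfl⟩
  rw [← hK₃] at e2
  obtain ⟨hE2l, hE2u⟩ := abs_le.mp hE2
  have hU2K : 36 * (U ^ 2 * K₂) ≤ T ^ 2 * K₂ := by
    have : (6 * U) ^ 2 * K₂ ≤ T ^ 2 * K₂ := by gcongr
    linarith
  have hU2K0 : 0 ≤ U ^ 2 * K₂ := by positivity
  have hT2 : 0 < T ^ 2 := by positivity
  -- The discrepancy is compared with `T²` only, not `U²`, so `K₃ = 0` remains possible.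
  have hK3 : 0 ≤ K₃ := by
    by_contra! h
    have : T ^ 2 * K₃ ≤ T ^ 2 * (-1) := by gcongr; omega
    linarith
  have hK3K2 : K₃ < K₂ := by
    by_contra! h
    have : T ^ 2 * K₂ ≤ T ^ 2 * K₃ := by gcongr
    have : T ^ 2 * 1 ≤ T ^ 2 * K₂ := by gcongr
    linarith
  have hy : 0 ≤ 4 * f ^ 2 - 3 := by linarith
  have hP : (4 * f ^ 2 - 3) ^ 3 * K₂ ≤ 2 * n ^ 2 + n := by
    have g1 : (4 * f ^ 2 - 3) * K₂ ≤ K₁ := by linarith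
    have g2 : (4 * f ^ 2 - 3) * K₁ ≤ q := by linarith
    have g3 : (4 * f ^ 2 - 3) * q ≤ 2 * n ^ 2 + n := by linarith
    calc (4 * f ^ 2 - 3) ^ 3 * K₂
        = (4 * f ^ 2 - 3) * ((4 * f ^ 2 - 3) * ((4 * f ^ 2 - 3) * K₂)) := by ring
      _ ≤ (4 * f ^ 2 - 3) * ((4 * f ^ 2 - 3) * K₁) := by gcongr
      _ ≤ (4 * f ^ 2 - 3) * q := by gcongr
      _ ≤ _ := g3
  obtain ⟨hf9, rfl⟩ := final_power_bound hb0 hK2 hf hn hcb hbc h29 hcon hP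
  obtain rfl : K₃ = 0 := by omega
  refine two_mul_sq_add_ne hρ hf hf9 (by linarith : 0 < n) ?_
  -- With `D = 4f² - 2`: `K₁ = D`, `q = D² - 1`, `2n² + ρn = D³ - 2D`.
  linear_combination hK₁ + (4 * f ^ 2 - 2) * hK₂ + ((4 * f ^ 2 - 2) ^ 2 - 1) * hK₃

end Descent

/-! ### From real exponents to integer powers, and the conclusion. -/

theorem pow_le_pow_of_rpow_le {b c : ℕ} {x : ℝ} (hb : 1 ≤ b) (hx : 1.16 ≤ x)
    (h : (b : ℝ) ^ x ≤ c) : b ^ 29 ≤ c ^ 25 := by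
  have hb' : (1 : ℝ) ≤ b := by exact_mod_cast hb
  have h1 : (b : ℝ) ^ (1.16 : ℝ) ≤ c := (Real.rpow_le_rpow_of_exponent_le hb' hx).trans h
  have h2 : ((b : ℝ) ^ (1.16 : ℝ)) ^ 25 ≤ (c : ℝ) ^ 25 := by gcongr
  rw [← Real.rpow_mul_natCast (by positivity),
    show (1.16 : ℝ) * ((25 : ℕ) : ℝ) = ((29 : ℕ) : ℝ) by norm_num, Real.rpow_natCast] at h2
  exact_mod_cast h2

theorem pow_lt_pow_of_lt_rpow {b c : ℕ} {x : ℝ} (hb : 1 ≤ b) (hx : x ≤ 1.40)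
    (h : (c : ℝ) < (b : ℝ) ^ x) : c ^ 5 < b ^ 7 := by
  have hb' : (1 : ℝ) ≤ b := by exact_mod_cast hb
  have h1 : (c : ℝ) < (b : ℝ) ^ (1.40 : ℝ) :=
    h.trans_le (Real.rpow_le_rpow_of_exponent_le hb' hx)
  have h2 : (c : ℝ) ^ 5 < ((b : ℝ) ^ (1.40 : ℝ)) ^ 5 := by gcongr
  rw [← Real.rpow_mul_natCast (by positivity),
    show (1.40 : ℝ) * ((5 : ℕ) : ℝ) = ((7 : ℕ) : ℝ) by norm_num, Real.rpow_natCast] at h2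
  exact_mod_cast h2

theorem rpow_quarter_le {b c n : ℕ} {k : ℝ} (hc : 0 < c) (hk0 : 0 ≤ k) (hk : k ≤ 16)
    (h : 16 * b ^ 2 ≤ n ^ 4 * c) : (k * (b : ℝ) ^ 2 / (c : ℝ)) ^ (1 / 4 : ℝ) ≤ n := by
  have hc' : (0 : ℝ) < c := by exact_mod_cast hc
  have h' : 16 * (b : ℝ) ^ 2 ≤ (n : ℝ) ^ 4 * c := by exact_mod_cast h
  have h1 : k * (b : ℝ) ^ 2 / c ≤ (n : ℝ) ^ 4 := by
    rw [div_le_iff₀ hc']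
    exact (by gcongr : k * (b : ℝ) ^ 2 ≤ 16 * (b : ℝ) ^ 2).trans h'
  calc (k * (b : ℝ) ^ 2 / (c : ℝ)) ^ (1 / 4 : ℝ) ≤ ((n : ℝ) ^ 4) ^ (1 / 4 : ℝ) := by gcongr
    _ = (n : ℝ) := by
      rw [one_div]
      exact_mod_cast Real.pow_rpow_inv_natCast (n := 4) (Nat.cast_nonneg n) (by norm_num)

/-- The bound behind all four ranges of `c`. -/
theorem sixteen_mul_sq_le_of_seqV_eq_seqW {b c r s t m n : ℕ} {ρ : ℤ} (hb : 1 < b) (hbc : b < c)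
    (hr : b = r ^ 2 + 1) (hs : c = s ^ 2 + 1) (ht : b * c = t ^ 2 + 1)
    (hρ : ρ = 1 ∨ ρ = -1) (h : seqV c s m = seqW b c r s t ρ n) (hn : 1000 ≤ n)
    (h29 : b ^ 29 ≤ c ^ 25) (h7 : c ^ 5 < b ^ 7) : 16 * b ^ 2 ≤ n ^ 4 * c := by
  have hm := le_two_mul_of_seqV_eq_seqW hb hbc hr hs ht hρ h
  rw [seqV_eq hs, seqW_eq (by omega) ht] at h
  have h' := Int.cast_injective (α := ℝ) h
  zify at hr hs ht hb hbc hm hn h29 h7 ⊢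
  have hdvd := dvd_of_pellPow_eq (by linarith) hr hs ht h'
  have hr0 : (0 : ℤ) < r := by
    rcases (Int.natCast_nonneg r).eq_or_lt with h0 | h0
    · rw [← h0] at hr; linarith
    · exact h0
  have hrs : (r : ℤ) < s := by
    apply lt_of_pow_lt_pow_left₀ 2 (by positivity)
    linarith
  have ht2 : (t : ℤ) ^ 2 = (r * s) ^ 2 + r ^ 2 + s ^ 2 := by
    rw [hr, hs] at ht
    linear_combination -ht
  have hf0 : (0 : ℤ) < t - r * s := by
    rw [sub_pos]
    apply lt_of_pow_lt_pow_left₀ 2 (by positivity)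
    have : 0 < (r : ℤ) ^ 2 := by positivity
    rw [ht2]
    linarith [sq_nonneg (s : ℤ)]
  exact sixteen_mul_sq_le hr0 hrs hf0 hr hs (by linear_combination ht2) h7 h29 hρ hn
    (by positivity) hm hdvd

theorem mainTheorem10
    (b c d r s t z m n : ℕ) (ρ : ℤ)
    (hquad : IsDQuadruple b c d)
    (hr : b = r ^ 2 + 1) (hs : c = s ^ 2 + 1) (ht : b * c = t ^ 2 + 1)
    (hz : c * d = z ^ 2 + 1)
    (hρ : ρ = 1 ∨ ρ = -1)
    (hzv : (z : ℝ) = seqV c s m)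
    (hzw : (z : ℝ) = seqW b c r s t ρ n)
    (hn : 1000 ≤ n) :
    ((b : ℝ) ^ (1.32 : ℝ) ≤ (c : ℝ) → (c : ℝ) < (b : ℝ) ^ (1.40 : ℝ) →
      (n : ℝ) ≥ (15.927 * (b : ℝ) ^ 2 / (c : ℝ)) ^ (1 / 4 : ℝ)) ∧
    ((b : ℝ) ^ (1.27 : ℝ) ≤ (c : ℝ) → (c : ℝ) < (b : ℝ) ^ (1.32 : ℝ) →
      (n : ℝ) ≥ (15.830 * (b : ℝ) ^ 2 / (c : ℝ)) ^ (1 / 4 : ℝ)) ∧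
    ((b : ℝ) ^ (1.22 : ℝ) ≤ (c : ℝ) → (c : ℝ) < (b : ℝ) ^ (1.27 : ℝ) →
      (n : ℝ) ≥ (15.387 * (b : ℝ) ^ 2 / (c : ℝ)) ^ (1 / 4 : ℝ)) ∧
    ((b : ℝ) ^ (1.16 : ℝ) ≤ (c : ℝ) → (c : ℝ) < (b : ℝ) ^ (1.22 : ℝ) →
      (n : ℝ) ≥ (12.850 * (b : ℝ) ^ 2 / (c : ℝ)) ^ (1 / 4 : ℝ)) := by
  obtain ⟨hb, hbc, -, -⟩ := hquad
  have key : ∀ x y k : ℝ, 1.16 ≤ x → y ≤ 1.40 → 0 ≤ k → k ≤ 16 → (b : ℝ) ^ x ≤ c →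
      (c : ℝ) < (b : ℝ) ^ y → (k * (b : ℝ) ^ 2 / (c : ℝ)) ^ (1 / 4 : ℝ) ≤ n :=
    fun x y k hx hy hk0 hk hbx hby ↦ rpow_quarter_le (by omega) hk0 hk
      (sixteen_mul_sq_le_of_seqV_eq_seqW hb hbc hr hs ht hρ (hzv.symm.trans hzw) hn
        (pow_le_pow_of_rpow_le hb.le hx hbx) (pow_lt_pow_of_lt_rpow hb.le hy hby))
  refine ⟨key _ _ _ ?_ ?_ ?_ ?_, key _ _ _ ?_ ?_ ?_ ?_, key _ _ _ ?_ ?_ ?_ ?_,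
    key _ _ _ ?_ ?_ ?_ ?_⟩ <;> norm_num
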